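/- Let $\mathbb D_-=\{z\in\mathbb C:|z|>1\}\cup\{\infty\}$ be the exterior disc in the Riemann sphere, and let $\Sigma'$ be the class of univalent (injective holomorphic) maps $\phi:\mathbb D_-\to\mathbb D_-$ with $\phi(\infty)=\infty$ and $\phi'(\infty)>0$, i.e. $\phi(z)=b_1z+\cdots$ at infinity with $b_1>0$. For $\phi\in\Sigma'$ and $\theta\in\mathbb R$ put $\phi_\theta(z)=e^{i\theta}\phi(ze^{-i\theta})$, and for an integer $n\ge 1$ let the Koebe transform $(K_n\phi)(z)=\sqrt[n]{\phi(z^n)}$ be the holomorphic branch of the root on $\mathbb D_-\setminus\{\infty\}$ with positive leading coefficient at $\infty$. **Theorem (the conformal snowflake is well defined).** Let $\phi\in\Sigma'$, let $k\ge2$ be an integer and let $(\theta_n)_{n\ge0}$ be any sequence of real numbers (angles). Define $f_0=\phi_{\theta_0}$ and $f_n=f_{n-1}\circ K_{k^n}\phi_{\theta_n}$ for $n\ge1$. Then there is $f\in\Sigma'$ such that $f_n\to f$ uniformly on every compact subset of $\mathbb D_-$: uniformly in the Euclidean metric on every compact subset of $\{z\in\mathbb C:|z|>1\}$, and uniformly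 in the spherical metric on every compact subset of $\mathbb D_-$ (which may contain $\infty$). -/

import Mathlib

open Filter Topology

/-- The finite part `{z ∈ ℂ : |z| > 1}` of the exterior disc. -/
def finiteExterior : Set ℂ := {z | 1 < ‖z‖}

/-- The exterior disc `𝔻₋ = {z : |z| > 1} ∪ {∞}`, a subset of the Riemann sphere
`OnePoint ℂ = ℂ ∪ {∞}`. -/
def exteriorDisc : Set (OnePoint ℂ) :=
  ((↑) : ℂ → OnePoint ℂ) '' finiteExterior ∪ {OnePoint.infty}

/-- `φ(∞) = ∞` and `φ(z) = b z + …` at infinity with a (finite) leading coefficient `b > 0`. -/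
def PositiveAtInfinity (φ : ℂ → ℂ) : Prop :=
  ∃ b : ℝ, 0 < b ∧ Tendsto (fun z => φ z / z) (Bornology.cobounded ℂ) (𝓝 (b : ℂ))

/-- The class `Σ'` of univalent maps `φ : 𝔻₋ → 𝔻₋` with `φ(∞) = ∞` and `φ'(∞) > 0`.
A map is represented by its restriction to finite points (it sends `∞` to `∞`), and only its
values on `finiteExterior` matter. Given injectivity, being holomorphic at `∞` with `φ(∞) = ∞`
means having a simple pole there, that is, `φ(z) / z` has a finite nonzero limit. -/
structure SigmaPrime (φ : ℂ → ℂ) : Prop where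
  holo : DifferentiableOn ℂ φ finiteExterior
  inj : Set.InjOn φ finiteExterior
  mapsTo : Set.MapsTo φ finiteExterior finiteExterior
  atInfinity : PositiveAtInfinity φ

/-- The rotation `φ_θ(z) = e^{iθ} φ(z e^{-iθ})`. -/
noncomputable def rotate (φ : ℂ → ℂ) (θ : ℝ) (z : ℂ) : ℂ :=
  Complex.exp (θ * Complex.I) * φ (z * Complex.exp (-(θ * Complex.I)))

/-- `g` is the holomorphic branch of `z ↦ (φ(zⁿ))^{1/n}` on the exterior disc with positive
leading coefficient at infinity. -/
def IsKoebeBranch (n : ℕ) (φ g : ℂ → ℂ) : Prop :=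
  DifferentiableOn ℂ g finiteExterior ∧
    (∀ z ∈ finiteExterior, g z ^ n = φ (z ^ n)) ∧ PositiveAtInfinity g

/-- The Koebe `n`-root transform `(K_n φ)(z) = (φ(zⁿ))^{1/n}`. For `φ` in `Σ'` and `n ≥ 1` the
branch exists and its values on the exterior disc are unique; elsewhere they are irrelevant. -/
noncomputable def koebe (n : ℕ) (φ : ℂ → ℂ) : ℂ → ℂ :=
  Classical.epsilon (IsKoebeBranch n φ)

/-- The `n`-th approximation to the conformal snowflake with building block `φ`, integer `k` and
rotations `θ`: `f_0 = φ_{θ_0}` and `f_n = f_{n-1} ∘ K_{k^n} φ_{θ_n}`. -/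
noncomputable def snowflakeApprox (φ : ℂ → ℂ) (k : ℕ) (θ : ℕ → ℝ) : ℕ → ℂ → ℂ
  | 0 => rotate φ (θ 0)
  | n + 1 => snowflakeApprox φ k θ n ∘ koebe (k ^ (n + 1)) (rotate φ (θ (n + 1)))

/-- Uniform convergence on `K` of sphere-valued maps on the Riemann sphere, with respect to the
unique uniform structure of the compact space `OnePoint ℂ` (that of the spherical metric). -/
def SphericallyUniformOn (F : ℕ → OnePoint ℂ → OnePoint ℂ) (f : OnePoint ℂ → OnePoint ℂ)
    (K : Set (OnePoint ℂ)) : Prop :=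
  @TendstoUniformlyOn (OnePoint ℂ) (OnePoint ℂ) ℕ uniformSpaceOfCompactR1 F f atTop K

/-! Write `φ z = z * exp (l z⁻¹)` with `l` holomorphic in the unit disc. The Koebe `N`-root
transform of a rotation of `φ` is then `z * exp (l (u * z⁻ᴺ) / N)` with `|u| = 1`, so for `N = kⁿ`
it tends to the identity like `2⁻ⁿ`. On the punctured disc `0 ≤ Re l` by the Schwarz lemma, so every
factor is expanding; `Re l ≤ A` by univalence, so the growth constants of the factors have a
convergent product.

Compositions therefore grow at most linearly with one common constant, and the Schwarz lemma turns
this into a Lipschitz bound on `|z| ≥ r` (`norm_sub_le_of_linear_growth`). Inserting one more inner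
factor changes the composition by `O(2⁻ⁿ|z|)`, so the sequence is uniformly Cauchy relative to `|z|`
(`exists_dist_tailComp_le`). The limit is injective because it factors through tails that tend to
the identity (`injOn_limit`), and its leading coefficient is at least 1 by expansion. Expansion also
controls a neighbourhood of `∞` uniformly in `n`, which gives spherical convergence. -/

theorem isOpen_finiteExterior : IsOpen finiteExterior :=
  isOpen_lt continuous_const continuous_norm

theorem ne_zero_of_mem_finiteExterior {z : ℂ} (hz : z ∈ finiteExterior) : z ≠ 0 := by
  rintro rfl
  have : (1 : ℝ) < ‖(0 : ℂ)‖ := hz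
  norm_num at this

theorem inv_mem_ball_of_mem_finiteExterior {z : ℂ} (hz : z ∈ finiteExterior) :
    z⁻¹ ∈ Metric.ball (0 : ℂ) 1 := by
  rw [mem_ball_zero_iff, norm_inv]
  exact inv_lt_one_of_one_lt₀ hz

theorem inv_mem_finiteExterior {w : ℂ} (hw : w ∈ Metric.ball (0 : ℂ) 1) (h0 : w ≠ 0) :
    w⁻¹ ∈ finiteExterior := by
  rw [mem_ball_zero_iff] at hw
  change 1 < ‖w⁻¹‖
  rw [norm_inv]
  exact (one_lt_inv₀ (norm_pos_iff.2 h0)).2 hw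

theorem pow_mem_finiteExterior {z : ℂ} (hz : z ∈ finiteExterior) {n : ℕ} (hn : n ≠ 0) :
    z ^ n ∈ finiteExterior := by
  change 1 < ‖z ^ n‖
  rw [norm_pow]
  exact one_lt_pow₀ hz hn

/-! ### The logarithm of `φ(z)/z` and bounds for its real part -/

/-- A zero-free holomorphic function on a disc has a holomorphic logarithm. -/
theorem exists_eq_exp_on_ball {f : ℂ → ℂ} {c : ℂ} {r : ℝ} (hr : 0 < r)
    (hf : DifferentiableOn ℂ f (Metric.ball c r)) (h0 : ∀ z ∈ Metric.ball c r, f z ≠ 0) :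
    ∃ g : ℂ → ℂ, DifferentiableOn ℂ g (Metric.ball c r) ∧ g c = Complex.log (f c) ∧
      ∀ z ∈ Metric.ball c r, f z = Complex.exp (g z) := by
  have hc : c ∈ Metric.ball c r := Metric.mem_ball_self hr
  have hd : DifferentiableOn ℂ (fun z => deriv f z / f z) (Metric.ball c r) :=
    (hf.deriv Metric.isOpen_ball).div hf h0
  obtain ⟨g, hgc, hg⟩ := hd.isExactOn_ball.with_val_at c (Complex.log (f c))
  refine ⟨g, fun z hz => (hg z hz).differentiableAt.differentiableWithinAt, hgc, fun z hz => ?_⟩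
  have key : f z * Complex.exp (-g z) = f c * Complex.exp (-g c) := by
    refine (convex_ball c r).is_const_of_fderivWithin_eq_zero (𝕜 := ℂ)
      (f := fun z => f z * Complex.exp (-g z)) ?_ ?_ hz hc
    · intro x hx
      exact ((hf x hx).mul
        ((hg x hx).differentiableAt.neg.cexp.differentiableWithinAt))
    · intro x hx
      have h1 : HasDerivAt f (deriv f x) x :=
        (hf.differentiableAt (Metric.isOpen_ball.mem_nhds hx)).hasDerivAt
      have h2 := h1.mul (hg x hx).neg.cexp
      have h3 : deriv f x * Complex.exp (-g x) +
          f x * (Complex.exp (-g x) * -(deriv f x / f x)) = 0 := by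
        have := h0 x hx
        field_simp
        ring
      rw [fderivWithin_of_isOpen Metric.isOpen_ball hx]
      have h4 : HasDerivAt (fun z => f z * Complex.exp (-g z)) 0 x := by
        rw [← h3]; exact h2
      ext
      simpa using h4.deriv
  rw [hgc, Complex.exp_neg, Complex.exp_neg, Complex.exp_log (h0 c hc), mul_inv_cancel₀ (h0 c hc)]
    at key
  have := Complex.exp_ne_zero (g z)
  field_simp at key
  exact key

/-- A map in `Σ'` has the form `φ(z) = z exp(ℓ(1/z))` with `ℓ` holomorphic in the unit disc. -/
theorem SigmaPrime.exists_log {φ : ℂ → ℂ} (hφ : SigmaPrime φ) :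
    ∃ l : ℂ → ℂ, DifferentiableOn ℂ l (Metric.ball 0 1) ∧ (∃ c : ℝ, l 0 = c) ∧
      ∀ z ∈ finiteExterior, φ z = z * Complex.exp (l z⁻¹) := by
  obtain ⟨b, hb, hlim⟩ := hφ.atInfinity
  -- In the coordinate `w = 1/z` the singularity at `∞` is removable, with value the leading
  -- coefficient.
  set p : ℂ → ℂ := Function.update (fun w => w * φ w⁻¹) 0 (b : ℂ) with hp
  have hp0 : p 0 = b := by simp [hp]
  have hpw : ∀ w, w ≠ 0 → p w = w * φ w⁻¹ := fun w hw => by simp [hp, hw]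
  have hpd : DifferentiableOn ℂ p (Metric.ball 0 1) := by
    rw [← Complex.differentiableOn_compl_singleton_and_continuousAt_iff
      (Metric.ball_mem_nhds (0 : ℂ) one_pos)]
    constructor
    · have : DifferentiableOn ℂ (fun w : ℂ => w * φ w⁻¹) (Metric.ball 0 1 \ {0}) := by
        refine differentiableOn_id.mul (hφ.holo.comp ?_ ?_)
        · exact differentiableOn_inv.mono fun w hw => hw.2
        · exact fun w hw => inv_mem_finiteExterior hw.1 hw.2
      exact this.congr fun w hw => hpw w hw.2
    · rw [hp, continuousAt_update_same]
      have := hlim.comp (Filter.tendsto_inv₀_nhdsNE_zero (α := ℂ))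
      refine this.congr fun w => ?_
      simp [mul_comm]
  have hpne : ∀ w ∈ Metric.ball (0 : ℂ) 1, p w ≠ 0 := by
    intro w hw
    by_cases h : w = 0
    · rw [h, hp0]; exact_mod_cast hb.ne'
    · rw [hpw w h]
      exact mul_ne_zero h (ne_zero_of_mem_finiteExterior (hφ.mapsTo (inv_mem_finiteExterior hw h)))
  obtain ⟨l, hl, hl0, hle⟩ := exists_eq_exp_on_ball one_pos hpd hpne
  refine ⟨l, hl, ⟨Real.log b, ?_⟩, fun z hz => ?_⟩
  · rw [hl0, hp0, Complex.ofReal_log hb.le]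
  · have hz0 := ne_zero_of_mem_finiteExterior hz
    rw [← hle _ (inv_mem_ball_of_mem_finiteExterior hz), hpw _ (inv_ne_zero hz0), inv_inv,
      mul_inv_cancel_left₀ hz0]

/-- `|z| ≤ |φ(z)|` for maps in `Σ'`, in terms of the logarithm. -/
theorem SigmaPrime.zero_le_re_log {φ l : ℂ → ℂ} (hφ : SigmaPrime φ)
    (hl : DifferentiableOn ℂ l (Metric.ball 0 1))
    (hle : ∀ z ∈ finiteExterior, φ z = z * Complex.exp (l z⁻¹)) {w : ℂ}
    (hw : w ∈ Metric.ball (0 : ℂ) 1) (hw0 : w ≠ 0) : 0 ≤ (l w).re := by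
  -- Schwarz lemma for `1 / φ(1/w)`, a self-map of the disc fixing 0.
  have h := Complex.norm_le_norm_of_mapsTo_ball (f := fun w => w * Complex.exp (-l w)) (R := 1)
    (z := w) (differentiableOn_id.mul hl.neg.cexp) ?_ (by simp) (by simpa using hw)
  · rw [norm_mul, Complex.norm_exp] at h
    have h1 : Real.exp (-l w).re ≤ 1 :=
      le_of_mul_le_mul_left (by simpa using h) (norm_pos_iff.2 hw0)
    simpa using h1
  · intro w hw
    by_cases h : w = 0
    · simp [h]
    have h1 := hφ.mapsTo (inv_mem_finiteExterior hw h)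
    rw [hle _ (inv_mem_finiteExterior hw h), inv_inv] at h1
    have h2 := Metric.ball_subset_closedBall (inv_mem_ball_of_mem_finiteExterior h1)
    simpa [Complex.exp_neg, mul_comm] using h2

/-- `φ(z) / z` is bounded for maps in `Σ'`, in terms of the logarithm. -/
theorem SigmaPrime.exists_re_log_le {φ l : ℂ → ℂ} (hφ : SigmaPrime φ)
    (hl : DifferentiableOn ℂ l (Metric.ball 0 1))
    (hle : ∀ z ∈ finiteExterior, φ z = z * Complex.exp (l z⁻¹)) :
    ∃ A : ℝ, 0 ≤ A ∧ ∀ w ∈ Metric.ball (0 : ℂ) 1, (l w).re ≤ A := by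
  set ψ : ℂ → ℂ := fun w => w * Complex.exp (-l w) with hψ
  have hψd : DifferentiableOn ℂ ψ (Metric.ball 0 1) := differentiableOn_id.mul hl.neg.cexp
  have hψ0 : ψ 0 = 0 := by simp [hψ]
  have hψφ : ∀ w ∈ Metric.ball (0 : ℂ) 1, w ≠ 0 → ψ w = (φ w⁻¹)⁻¹ := by
    intro w hw h
    rw [hle _ (inv_mem_finiteExterior hw h), inv_inv]
    simp [hψ, Complex.exp_neg, mul_comm]
  have hψne : ∀ w, w ≠ 0 → ψ w ≠ 0 := fun w h => mul_ne_zero h (Complex.exp_ne_zero _)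
  have hinj : Set.InjOn ψ (Metric.ball 0 1) := by
    intro w hw w' hw' h
    by_cases h0 : w = 0
    · by_contra hne
      rw [h0, hψ0] at h
      exact hψne w' (fun h' => hne (h0.trans h'.symm)) h.symm
    by_cases h0' : w' = 0
    · rw [h0', hψ0] at h
      exact absurd h (hψne w h0)
    rw [hψφ w hw h0, hψφ w' hw' h0'] at h
    exact inv_injective (hφ.inj (inv_mem_finiteExterior hw h0) (inv_mem_finiteExterior hw' h0')
      (inv_injective h))
  -- Open mapping at 0: `ψ` vanishes only at 0, so it is not locally constant there.
  have hopen : 𝓝 (ψ 0) ≤ map ψ (𝓝 0) := by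
    have han : AnalyticAt ℂ ψ 0 := hψd.analyticAt (Metric.ball_mem_nhds _ one_pos)
    refine han.eventually_constant_or_nhds_le_map_nhds.resolve_left fun hev => ?_
    have : ∀ᶠ w in 𝓝[≠] (0 : ℂ), False := by
      filter_upwards [hev.filter_mono nhdsWithin_le_nhds, self_mem_nhdsWithin] with w hw h0
      exact hψne w h0 (hw.trans hψ0)
    exact this.exists.elim fun _ h => h
  have hmem : ψ '' Metric.ball 0 (1 / 2) ∈ 𝓝 (ψ 0) :=
    hopen (image_mem_map (Metric.ball_mem_nhds _ (by norm_num)))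
  rw [hψ0, Metric.mem_nhds_iff] at hmem
  obtain ⟨ε, hε, hsub⟩ := hmem
  have hcont : ContinuousOn (fun w => (l w).re) (Metric.closedBall 0 (1 / 2)) :=
    Complex.continuous_re.comp_continuousOn
      (hl.continuousOn.mono (Metric.closedBall_subset_ball (by norm_num)))
  obtain ⟨B, hB⟩ := (isCompact_closedBall (0 : ℂ) (1 / 2)).bddAbove_image hcont
  refine ⟨max (max B 0) (-Real.log ε), le_max_of_le_left (le_max_right _ _), fun w hw => ?_⟩
  by_cases h : w ∈ Metric.closedBall (0 : ℂ) (1 / 2)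
  · exact le_max_of_le_left (le_max_of_le_left (hB ⟨w, h, rfl⟩))
  · refine le_max_of_le_right ?_
    -- All values of modulus below `ε` are already taken in the half disc; by injectivity `ψ` cannot
    -- take them again outside it.
    have h1 : ε ≤ ‖ψ w‖ := by
      by_contra! hlt
      obtain ⟨w', hw', he⟩ := hsub (mem_ball_zero_iff.2 hlt)
      have := hinj (Metric.ball_subset_ball (by norm_num) hw') hw he
      exact h (this ▸ Metric.ball_subset_closedBall hw')
    have h2 : ‖ψ w‖ ≤ Real.exp (-(l w).re) := by
      rw [hψ, norm_mul, Complex.norm_exp, Complex.neg_re]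
      exact mul_le_of_le_one_left (Real.exp_pos _).le (mem_ball_zero_iff.1 hw).le
    have h3 := (Real.log_le_iff_le_exp hε).2 (h1.trans h2)
    linarith

/-! ### The Koebe transform in explicit form -/

theorem isPreconnected_finiteExterior : IsPreconnected finiteExterior := by
  have h : finiteExterior = Complex.exp '' {z | 0 < z.re} := by
    ext z
    constructor
    · intro hz
      refine ⟨Complex.log z, ?_, Complex.exp_log (ne_zero_of_mem_finiteExterior hz)⟩
      simpa [Complex.log_re] using Real.log_pos hz
    · rintro ⟨w, hw, rfl⟩
      change 1 < ‖Complex.exp w‖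
      rw [Complex.norm_exp]
      exact Real.one_lt_exp_iff.2 hw
  rw [h]
  exact (convex_halfSpace_re_gt 0).isPreconnected.image _ Complex.continuous_exp.continuousOn

theorem finiteExterior_mem_cobounded : finiteExterior ∈ Bornology.cobounded ℂ := by
  filter_upwards [(tendsto_norm_cobounded_atTop (E := ℂ)).eventually_gt_atTop 1] with z hz
  exact hz

/-- The Koebe branch is unique. -/
theorem IsKoebeBranch.eqOn {n : ℕ} (hn : n ≠ 0) {φ g₁ g₂ : ℂ → ℂ}
    (hφ : ∀ z ∈ finiteExterior, φ z ≠ 0)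
    (h₁ : IsKoebeBranch n φ g₁) (h₂ : IsKoebeBranch n φ g₂) : Set.EqOn g₁ g₂ finiteExterior := by
  obtain ⟨hd₁, hp₁, b₁, hb₁, hl₁⟩ := h₁
  obtain ⟨hd₂, hp₂, b₂, hb₂, hl₂⟩ := h₂
  have hne : ∀ z ∈ finiteExterior, g₂ z ≠ 0 := by
    intro z hz h0
    apply hφ _ (pow_mem_finiteExterior hz hn)
    rw [← hp₂ z hz, h0, zero_pow hn]
  have hT : ({w : ℂ | w ^ n = 1} : Set ℂ).Finite := by
    refine ((Polynomial.nthRoots n (1 : ℂ)).toFinset.finite_toSet).subset fun w hw => ?_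
    simpa [Polynomial.mem_nthRoots (Nat.pos_of_ne_zero hn)] using hw
  -- The quotient of two branches is continuous with values in the `n`-th roots of unity, hence
  -- constant; the leading coefficients make this constant positive, so it is 1.
  obtain ⟨c, hc, heq⟩ := isPreconnected_finiteExterior.eqOn_const_of_mapsTo hT.isDiscrete
    (f := fun z => g₁ z / g₂ z) (hd₁.continuousOn.div hd₂.continuousOn hne)
    (fun z hz => by
      change (g₁ z / g₂ z) ^ n = 1
      rw [div_pow, hp₁ z hz, hp₂ z hz, div_self (hφ _ (pow_mem_finiteExterior hz hn))])
    ⟨1, one_pow n⟩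
  have hlim : Tendsto (fun _ : ℂ => c) (Bornology.cobounded ℂ) (𝓝 ((b₁ : ℂ) / b₂)) := by
    refine (hl₁.div hl₂ (by exact_mod_cast hb₂.ne')).congr' ?_
    filter_upwards [finiteExterior_mem_cobounded] with z hz
    have hz0 := ne_zero_of_mem_finiteExterior hz
    rw [Pi.div_apply, div_div_div_cancel_right₀ hz0]
    exact heq hz
  have hcb : c = ((b₁ / b₂ : ℝ) : ℂ) := by
    rw [tendsto_nhds_unique tendsto_const_nhds hlim]; push_cast; rfl
  have hc1 : c = 1 := by
    have h : (b₁ / b₂) ^ n = 1 := by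
      have : c ^ n = 1 := hc
      rw [hcb] at this
      exact_mod_cast this
    rw [hcb, (pow_eq_one_iff_of_nonneg (div_pos hb₁ hb₂).le hn).1 h, Complex.ofReal_one]
  intro z hz
  have := heq hz
  rw [Function.const_apply, hc1] at this
  exact (div_eq_one_iff_eq (hne z hz)).1 this

/-- The map `z ↦ z exp(ℓ(u z⁻ᴺ) / N)`. If `φ(z) = z exp(ℓ(1/z))` and `u = exp(iθ)`, this is the
Koebe `N`-root transform of `φ_θ`. -/
noncomputable def koebeOfLog (l : ℂ → ℂ) (N : ℕ) (u : ℂ) (z : ℂ) : ℂ :=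
  z * Complex.exp (l (u * (z ^ N)⁻¹) / N)

theorem mul_inv_pow_mem_ball {u z : ℂ} (hu : ‖u‖ = 1) (hz : z ∈ finiteExterior) {N : ℕ}
    (hN : N ≠ 0) : u * (z ^ N)⁻¹ ∈ Metric.ball (0 : ℂ) 1 := by
  have := inv_mem_ball_of_mem_finiteExterior (pow_mem_finiteExterior hz hN)
  simpa [hu] using this

theorem rotate_eq_koebeOfLog {φ l : ℂ → ℂ}
    (hle : ∀ z ∈ finiteExterior, φ z = z * Complex.exp (l z⁻¹)) (θ : ℝ) {z : ℂ}
    (hz : z ∈ finiteExterior) :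
    rotate φ θ z = koebeOfLog l 1 (Complex.exp (θ * Complex.I)) z := by
  have h1 : z * Complex.exp (-(θ * Complex.I)) ∈ finiteExterior := by
    change 1 < ‖_‖
    rw [norm_mul, ← neg_mul, ← Complex.ofReal_neg, Complex.norm_exp_ofReal_mul_I, mul_one]
    exact hz
  rw [rotate, hle _ h1, koebeOfLog, mul_inv, ← Complex.exp_neg, neg_neg, pow_one,
    mul_comm z⁻¹, Nat.cast_one, div_one, mul_comm z, ← mul_assoc, ← mul_assoc, ← Complex.exp_add,
    add_neg_cancel, Complex.exp_zero, one_mul]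

theorem koebeOfLog_pow (l : ℂ → ℂ) {N : ℕ} (hN : N ≠ 0) (u z : ℂ) :
    koebeOfLog l N u z ^ N = koebeOfLog l 1 u (z ^ N) := by
  have : (N : ℂ) ≠ 0 := by exact_mod_cast hN
  simp only [koebeOfLog, mul_pow, ← Complex.exp_nat_mul, pow_one, Nat.cast_one, div_one]
  rw [mul_div_cancel₀ _ this]

theorem koebeOfLog_positiveAtInfinity {l : ℂ → ℂ} (hl : ContinuousAt l 0) {c : ℝ}
    (hc : l 0 = c) {N : ℕ} (hN : N ≠ 0) (u : ℂ) : PositiveAtInfinity (koebeOfLog l N u) := by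
  refine ⟨Real.exp (c / N), Real.exp_pos _, ?_⟩
  have h1 : Tendsto (fun z : ℂ => u * (z ^ N)⁻¹) (Bornology.cobounded ℂ) (𝓝 0) := by
    have h2 : Tendsto (fun z : ℂ => (z⁻¹) ^ N) (Bornology.cobounded ℂ) (𝓝 0) := by
      simpa [hN] using (tendsto_inv₀_cobounded (α := ℂ)).pow N
    simpa using h2.const_mul u
  have h3 := ((hl.tendsto.comp h1).div_const (N : ℂ)).cexp
  rw [hc] at h3
  push_cast
  refine h3.congr' ?_
  filter_upwards [finiteExterior_mem_cobounded] with z hz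
  rw [koebeOfLog, mul_div_cancel_left₀ _ (ne_zero_of_mem_finiteExterior hz)]
  rfl

theorem koebeOfLog_differentiableOn {l : ℂ → ℂ} (hl : DifferentiableOn ℂ l (Metric.ball 0 1))
    {N : ℕ} (hN : N ≠ 0) {u : ℂ} (hu : ‖u‖ = 1) :
    DifferentiableOn ℂ (koebeOfLog l N u) finiteExterior := by
  have h1 : DifferentiableOn ℂ (fun z : ℂ => u * (z ^ N)⁻¹) finiteExterior := by
    refine DifferentiableOn.const_mul (DifferentiableOn.inv (by fun_prop) fun z hz => ?_) u
    exact pow_ne_zero _ (ne_zero_of_mem_finiteExterior hz)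
  exact differentiableOn_id.mul
    (((hl.comp h1 fun z hz => mul_inv_pow_mem_ball hu hz hN).div_const (N : ℂ)).cexp)

theorem koebe_eqOn_koebeOfLog {φ l : ℂ → ℂ} (hl : DifferentiableOn ℂ l (Metric.ball 0 1))
    {c : ℝ} (hc : l 0 = c) (hle : ∀ z ∈ finiteExterior, φ z = z * Complex.exp (l z⁻¹))
    {N : ℕ} (hN : N ≠ 0) (θ : ℝ) :
    Set.EqOn (koebe N (rotate φ θ)) (koebeOfLog l N (Complex.exp (θ * Complex.I)))
      finiteExterior := by
  have hb : IsKoebeBranch N (rotate φ θ) (koebeOfLog l N (Complex.exp (θ * Complex.I))) := by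
    refine ⟨koebeOfLog_differentiableOn hl hN (Complex.norm_exp_ofReal_mul_I θ), fun z hz => ?_,
      koebeOfLog_positiveAtInfinity (hl.continuousOn.continuousAt
        (Metric.ball_mem_nhds _ one_pos)) hc hN _⟩
    rw [koebeOfLog_pow l hN, rotate_eq_koebeOfLog hle θ (pow_mem_finiteExterior hz hN)]
  refine IsKoebeBranch.eqOn hN (fun z hz => ?_) (Classical.epsilon_spec ⟨_, hb⟩) hb
  rw [rotate_eq_koebeOfLog hle θ hz]
  exact mul_ne_zero (ne_zero_of_mem_finiteExterior hz) (Complex.exp_ne_zero _)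

/-- Taking `N`-th powers and using injectivity of `φ` gives only `a ^ N = b ^ N`. But the
exponential factor depends on `z ^ N` alone, so it cancels and leaves `a = b`. -/
theorem koebeOfLog_injOn {φ l : ℂ → ℂ} (hφ : Set.InjOn φ finiteExterior)
    (hle : ∀ z ∈ finiteExterior, φ z = z * Complex.exp (l z⁻¹)) {N : ℕ} (hN : N ≠ 0) (θ : ℝ) :
    Set.InjOn (koebeOfLog l N (Complex.exp (θ * Complex.I))) finiteExterior := by
  intro a ha b hb h
  have h1 := congrArg (· ^ N) h
  simp only [koebeOfLog_pow l hN] at h1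
  have hrot : ∀ {z}, z ∈ finiteExterior → z * Complex.exp (-(θ * Complex.I)) ∈ finiteExterior := by
    intro z hz
    change 1 < ‖_‖
    rw [norm_mul, ← neg_mul, ← Complex.ofReal_neg, Complex.norm_exp_ofReal_mul_I, mul_one]
    exact hz
  have ha' := pow_mem_finiteExterior ha hN
  have hb' := pow_mem_finiteExterior hb hN
  rw [← rotate_eq_koebeOfLog hle θ ha', ← rotate_eq_koebeOfLog hle θ hb'] at h1
  have h2 := hφ (hrot ha') (hrot hb') (mul_left_cancel₀ (Complex.exp_ne_zero _) h1)
  have h3 : a ^ N = b ^ N := mul_right_cancel₀ (Complex.exp_ne_zero _) h2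
  rw [koebeOfLog, koebeOfLog, h3] at h
  exact mul_right_cancel₀ (Complex.exp_ne_zero _) h

/-! ### Geometric closeness to the identity and the Lipschitz estimate -/

/-- A sequence of expanding univalent maps of the exterior disc that approaches the identity at a
geometric rate. -/
structure GeometricallyNearId (g : ℕ → ℂ → ℂ) : Prop where
  holo : ∀ n, DifferentiableOn ℂ (g n) finiteExterior
  inj : ∀ n, Set.InjOn (g n) finiteExterior
  norm_le : ∀ n, ∀ z ∈ finiteExterior, ‖z‖ ≤ ‖g n z‖
  atInfinity : ∀ n, PositiveAtInfinity (g n)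
  le_norm : ∃ A : ℝ, 0 ≤ A ∧ ∀ n, ∀ z ∈ finiteExterior,
    ‖g n z‖ ≤ Real.exp (A * (1 / 2) ^ n) * ‖z‖
  close : ∀ r : ℝ, 1 < r → ∃ M : ℝ, 0 ≤ M ∧ ∀ n z, r ≤ ‖z‖ →
    ‖g n z - z‖ ≤ M * (1 / 2) ^ n * ‖z‖

theorem norm_exp_sub_one_le_mul_exp (x : ℂ) :
    ‖Complex.exp x - 1‖ ≤ ‖x‖ * Real.exp ‖x‖ := by
  simpa using Complex.norm_exp_sub_sum_le_norm_mul_exp x 1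

theorem inv_pow_le_half_pow {k : ℕ} (hk : 2 ≤ k) (n : ℕ) :
    (((k ^ n : ℕ) : ℝ))⁻¹ ≤ (1 / 2) ^ n := by
  rw [Nat.cast_pow, ← inv_pow, one_div]
  gcongr
  exact_mod_cast hk

theorem SigmaPrime.geometricallyNearId {φ l : ℂ → ℂ} (hφ : SigmaPrime φ)
    (hl : DifferentiableOn ℂ l (Metric.ball 0 1)) {c : ℝ} (hc : l 0 = c)
    (hle : ∀ z ∈ finiteExterior, φ z = z * Complex.exp (l z⁻¹)) {k : ℕ} (hk : 2 ≤ k)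
    (θ : ℕ → ℝ) :
    GeometricallyNearId fun n => koebeOfLog l (k ^ n) (Complex.exp (θ n * Complex.I)) := by
  have hN : ∀ n, k ^ n ≠ 0 := fun n => pow_ne_zero n (by omega)
  have hu : ∀ n, ‖Complex.exp (θ n * Complex.I)‖ = 1 := fun n => Complex.norm_exp_ofReal_mul_I _
  have hnorm : ∀ n z, ‖koebeOfLog l (k ^ n) (Complex.exp (θ n * Complex.I)) z‖ = ‖z‖ *
      Real.exp ((l (Complex.exp (θ n * Complex.I) * (z ^ k ^ n)⁻¹)).re / (k ^ n : ℕ)) := by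
    intro n z
    rw [koebeOfLog, norm_mul, Complex.norm_exp, Complex.div_natCast_re]
  refine ⟨fun n => koebeOfLog_differentiableOn hl (hN n) (hu n),
    fun n => koebeOfLog_injOn hφ.inj hle (hN n) (θ n), fun n z hz => ?_,
    fun n => koebeOfLog_positiveAtInfinity (hl.continuousOn.continuousAt
      (Metric.ball_mem_nhds _ one_pos)) hc (hN n) _, ?_, fun r hr => ?_⟩
  · rw [hnorm]
    have h0 := hφ.zero_le_re_log hl hle (mul_inv_pow_mem_ball (hu n) hz (hN n))
      (mul_ne_zero (Complex.exp_ne_zero _)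
        (inv_ne_zero (pow_ne_zero _ (ne_zero_of_mem_finiteExterior hz))))
    exact le_mul_of_one_le_right (norm_nonneg z) (Real.one_le_exp (by positivity))
  · obtain ⟨A, hA, hAl⟩ := hφ.exists_re_log_le hl hle
    refine ⟨A, hA, fun n z hz => ?_⟩
    rw [hnorm, mul_comm]
    gcongr
    rw [div_eq_mul_inv]
    exact mul_le_mul (hAl _ (mul_inv_pow_mem_ball (hu n) hz (hN n))) (inv_pow_le_half_pow hk n)
      (by positivity) hA
  · have hr0 : 0 < r := by linarith
    -- For `|z| ≥ r` and `N ≥ 1` the argument of `l` has modulus at most `1/r`, so one bound `B`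
    -- serves all `n`.
    obtain ⟨B, hB⟩ := (isCompact_closedBall (0 : ℂ) r⁻¹).exists_bound_of_continuousOn
      (hl.continuousOn.mono (Metric.closedBall_subset_ball (inv_lt_one_of_one_lt₀ hr)))
    have hB0 : 0 ≤ B := (norm_nonneg _).trans (hB 0 (by simp [hr0.le]))
    refine ⟨B * Real.exp B, by positivity, fun n z hz => ?_⟩
    have hz1 : 1 ≤ ‖z‖ := by linarith
    have hmem : Complex.exp (θ n * Complex.I) * (z ^ k ^ n)⁻¹ ∈ Metric.closedBall (0 : ℂ) r⁻¹ := by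
      rw [mem_closedBall_zero_iff, norm_mul, hu, one_mul, norm_inv, norm_pow]
      exact inv_anti₀ hr0 (hz.trans (le_self_pow₀ hz1 (hN n)))
    set x := l (Complex.exp (θ n * Complex.I) * (z ^ k ^ n)⁻¹) with hx
    have hxB : ‖x‖ ≤ B := hB _ hmem
    have hkn : (1 : ℝ) ≤ (k ^ n : ℕ) := by exact_mod_cast Nat.one_le_iff_ne_zero.2 (hN n)
    have hxn : ‖x / (k ^ n : ℕ)‖ ≤ B * (1 / 2) ^ n := by
      rw [norm_div, Complex.norm_natCast, div_eq_mul_inv]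
      exact mul_le_mul hxB (inv_pow_le_half_pow hk n) (by positivity) hB0
    have hxn' : ‖x / (k ^ n : ℕ)‖ ≤ B := by
      rw [norm_div, Complex.norm_natCast]
      exact (div_le_self (norm_nonneg _) hkn).trans hxB
    have h1 : koebeOfLog l (k ^ n) (Complex.exp (θ n * Complex.I)) z - z =
        z * (Complex.exp (x / (k ^ n : ℕ)) - 1) := by
      rw [koebeOfLog, ← hx]; ring
    rw [h1, norm_mul, mul_comm]
    gcongr
    calc ‖Complex.exp (x / (k ^ n : ℕ)) - 1‖
        ≤ ‖x / (k ^ n : ℕ)‖ * Real.exp ‖x / (k ^ n : ℕ)‖ := norm_exp_sub_one_le_mul_exp _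
      _ ≤ (B * (1 / 2) ^ n) * Real.exp B := by gcongr
      _ = B * Real.exp B * (1 / 2) ^ n := by ring

/-- A holomorphic map of linear growth on the exterior disc satisfies a Lipschitz estimate. -/
theorem norm_sub_le_of_linear_growth {F : ℂ → ℂ} (hF : DifferentiableOn ℂ F finiteExterior)
    {A r : ℝ} (hr : 1 < r) (hA : 0 ≤ A) (hFA : ∀ z ∈ finiteExterior, ‖F z‖ ≤ A * ‖z‖) {z w : ℂ}
    (hz : r ≤ ‖z‖) (hw : w ∈ finiteExterior) :
    ‖F w - F z‖ ≤ 8 * A / (1 - r⁻¹) * ‖w - z‖ := by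
  have hr0 : 0 < r := by linarith
  -- Since `(1 - δ) r = (r + 1) / 2 > 1`, the disc of radius `δ‖z‖` about `z` stays in the exterior.
  -- Schwarz applies inside it; outside it `‖z‖ ≤ ‖w - z‖ / δ`, and linear growth suffices.
  set δ : ℝ := (1 - r⁻¹) / 2 with hδ
  have hri : r⁻¹ < 1 := inv_lt_one_of_one_lt₀ hr
  have hri0 : 0 < r⁻¹ := inv_pos.2 hr0
  have hδ0 : 0 < δ := by rw [hδ]; linarith
  have hδ1 : δ < 1 / 2 := by rw [hδ]; linarith
  have hz0 : 0 < ‖z‖ := by linarith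
  have hzU : z ∈ finiteExterior := lt_of_lt_of_le hr hz
  have hK : 8 * A / (1 - r⁻¹) = 4 * A / δ := by
    have : 1 - r⁻¹ ≠ 0 := by linarith
    rw [hδ]; field_simp; ring
  rw [hK]
  by_cases hwz : ‖w - z‖ < δ * ‖z‖
  · have hball : ∀ v ∈ Metric.ball z (δ * ‖z‖), 1 < ‖v‖ ∧ ‖v‖ ≤ 2 * ‖z‖ := by
      intro v hv
      rw [mem_ball_iff_norm] at hv
      have h1 := norm_sub_norm_le z v
      have h2 := norm_sub_norm_le v z
      rw [norm_sub_rev z v] at h1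
      have h3 : 1 < (1 - δ) * r := by
        have : (1 - δ) * r = (r + 1) / 2 := by rw [hδ]; field_simp; ring
        linarith
      constructor
      · nlinarith
      · nlinarith
    have h := Complex.dist_le_div_mul_dist_of_mapsTo_ball (f := F) (c := z) (R₁ := δ * ‖z‖)
      (R₂ := 4 * A * ‖z‖) (z := w) (hF.mono fun v hv => (hball v hv).1) ?_
      (mem_ball_iff_norm.2 hwz)
    · rw [dist_eq_norm, dist_eq_norm, mul_div_mul_right _ _ hz0.ne'] at h
      exact h
    · intro v hv
      rw [mem_closedBall_iff_norm]
      have h1 := hFA v (hball v hv).1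
      have h2 := hFA z hzU
      have h3 := mul_le_mul_of_nonneg_left (hball v hv).2 hA
      have h4 : 0 ≤ A * ‖z‖ := by positivity
      linarith [norm_sub_le (F v) (F z)]
  · push Not at hwz
    have h1 := hFA w hw
    have h2 := hFA z hzU
    have h3 : ‖w‖ ≤ ‖w - z‖ + ‖z‖ := norm_le_norm_sub_add w z
    have h4 : ‖z‖ ≤ ‖w - z‖ / δ := (le_div_iff₀ hδ0).2 (by linarith)
    have h5 : ‖w - z‖ ≤ ‖w - z‖ / δ := le_div_self (norm_nonneg _) hδ0 (by linarith)
    calc ‖F w - F z‖ ≤ ‖F w‖ + ‖F z‖ := norm_sub_le _ _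
      _ ≤ A * (‖w - z‖ + 2 * ‖z‖) := by nlinarith
      _ ≤ A * (4 * (‖w - z‖ / δ)) := by
        gcongr
        have : 0 ≤ ‖w - z‖ / δ := by positivity
        linarith
      _ = 4 * A / δ * ‖w - z‖ := by ring

/-! ### Compositions and their limit -/

/-- The composition `g n ∘ g (n + 1) ∘ ⋯ ∘ g (n + m - 1)`. -/
def tailComp (g : ℕ → ℂ → ℂ) (n : ℕ) : ℕ → ℂ → ℂ
  | 0 => id
  | m + 1 => tailComp g n m ∘ g (n + m)

theorem tailComp_add (g : ℕ → ℂ → ℂ) (n m : ℕ) :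
    ∀ j, tailComp g n (m + j) = tailComp g n m ∘ tailComp g (n + m) j
  | 0 => rfl
  | j + 1 => by
    rw [← add_assoc, tailComp, tailComp_add g n m j, tailComp, Function.comp_assoc, add_assoc n]

namespace GeometricallyNearId

theorem mapsTo {g : ℕ → ℂ → ℂ} (hg : GeometricallyNearId g)
    (n : ℕ) : Set.MapsTo (g n) finiteExterior finiteExterior :=
  fun z hz => lt_of_lt_of_le hz (hg.norm_le n z hz)

theorem norm_le_tailComp {g : ℕ → ℂ → ℂ} (hg : GeometricallyNearId g)
    (n m : ℕ) : ∀ z ∈ finiteExterior, ‖z‖ ≤ ‖tailComp g n m z‖ := by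
  induction m with
  | zero => exact fun z _ => le_rfl
  | succ m ih => exact fun z hz => (hg.norm_le _ z hz).trans (ih _ (hg.mapsTo _ hz))

theorem differentiableOn_tailComp {g : ℕ → ℂ → ℂ} (hg : GeometricallyNearId g) (n m : ℕ) :
    DifferentiableOn ℂ (tailComp g n m) finiteExterior := by
  induction m with
  | zero => exact differentiableOn_id
  | succ m ih => exact ih.comp (hg.holo _) (hg.mapsTo _)

theorem injOn_tailComp {g : ℕ → ℂ → ℂ} (hg : GeometricallyNearId g)
    (n m : ℕ) : Set.InjOn (tailComp g n m) finiteExterior := by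
  induction m with
  | zero => exact Function.injective_id.injOn
  | succ m ih => exact ih.comp (hg.inj _) (hg.mapsTo _)

theorem tendsto_cobounded {g : ℕ → ℂ → ℂ} (hg : GeometricallyNearId g) (n : ℕ) :
    Tendsto (g n) (Bornology.cobounded ℂ) (Bornology.cobounded ℂ) := by
  rw [← tendsto_norm_atTop_iff_cobounded]
  refine tendsto_atTop_mono' _ ?_ (tendsto_norm_cobounded_atTop (E := ℂ))
  filter_upwards [finiteExterior_mem_cobounded] with z hz using hg.norm_le n z hz

theorem positiveAtInfinity_tailComp {g : ℕ → ℂ → ℂ} (hg : GeometricallyNearId g)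
    (n m : ℕ) : PositiveAtInfinity (tailComp g n m) := by
  induction m with
  | zero =>
    refine ⟨1, one_pos, tendsto_const_nhds.congr' ?_⟩
    filter_upwards [finiteExterior_mem_cobounded] with z hz
    simp [tailComp, ne_zero_of_mem_finiteExterior hz]
  | succ m ih =>
    obtain ⟨b, hb, hlb⟩ := ih
    obtain ⟨c, hc, hlc⟩ := hg.atInfinity (n + m)
    refine ⟨b * c, mul_pos hb hc, ?_⟩
    rw [Complex.ofReal_mul]
    refine ((hlb.comp (hg.tendsto_cobounded (n + m))).mul hlc).congr' ?_
    filter_upwards [finiteExterior_mem_cobounded] with z hz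
    exact div_mul_div_cancel₀ (ne_zero_of_mem_finiteExterior (hg.mapsTo _ hz))

theorem exists_tailComp_norm_le {g : ℕ → ℂ → ℂ} (hg : GeometricallyNearId g)
    : ∃ C : ℝ, 0 ≤ C ∧ ∀ n m, ∀ z ∈ finiteExterior,
    ‖tailComp g n m z‖ ≤ C * ‖z‖ := by
  obtain ⟨A, hA, hAg⟩ := hg.le_norm
  -- The exponent is the geometric sum of `A / 2ʲ` over `n ≤ j < n + m`.
  have key : ∀ n m, ∀ z ∈ finiteExterior, ‖tailComp g n m z‖ ≤
      Real.exp (2 * A * ((1 / 2) ^ n - (1 / 2) ^ (n + m))) * ‖z‖ := by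
    intro n m
    induction m with
    | zero => intro z _; simp [tailComp]
    | succ m ih =>
      intro z hz
      refine (ih _ (hg.mapsTo (n + m) hz)).trans ?_
      refine (mul_le_mul_of_nonneg_left (hAg _ z hz) (Real.exp_pos _).le).trans_eq ?_
      rw [← mul_assoc, ← Real.exp_add]
      congr 2
      ring
  refine ⟨Real.exp (2 * A), (Real.exp_pos _).le, fun n m z hz => (key n m z hz).trans ?_⟩
  refine mul_le_mul_of_nonneg_right (Real.exp_le_exp.2 ?_) (norm_nonneg z)
  refine mul_le_of_le_one_right (by positivity) ?_
  have h1 : (1 / 2 : ℝ) ^ n ≤ 1 := pow_le_one₀ (by norm_num) (by norm_num)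
  have h2 : (0 : ℝ) ≤ (1 / 2) ^ (n + m) := by positivity
  linarith

/-- The new factor is innermost, so the Lipschitz bound for the outer composition multiplies its
`O(2⁻⁽ⁿ⁺ᵐ⁾|z|)` displacement. Keeping the factor `2⁻ⁿ` lets tails tend to the identity; keeping
`|z|` gives control at `∞`. -/
theorem exists_dist_tailComp_le {g : ℕ → ℂ → ℂ} (hg : GeometricallyNearId g)
    {r : ℝ} (hr : 1 < r) : ∃ D : ℝ, 0 ≤ D ∧ ∀ n m z, r ≤ ‖z‖ →
    dist (tailComp g n m z) (tailComp g n (m + 1) z) ≤ D * (1 / 2) ^ n * ‖z‖ * (1 / 2) ^ m := by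
  obtain ⟨C, hC, hCg⟩ := hg.exists_tailComp_norm_le
  obtain ⟨M, hM, hMg⟩ := hg.close r hr
  have hri : r⁻¹ < 1 := inv_lt_one_of_one_lt₀ hr
  have hK : 0 ≤ 8 * C / (1 - r⁻¹) := div_nonneg (by positivity) (by linarith)
  refine ⟨8 * C / (1 - r⁻¹) * M, by positivity, fun n m z hz => ?_⟩
  rw [dist_comm, dist_eq_norm, tailComp, Function.comp_apply]
  refine (norm_sub_le_of_linear_growth (hg.differentiableOn_tailComp n m) hr hC (hCg n m) hz
    (hg.mapsTo _ (lt_of_lt_of_le hr hz))).trans ?_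
  refine (mul_le_mul_of_nonneg_left (hMg (n + m) z hz) hK).trans_eq ?_
  rw [pow_add]; ring

/-- The limit of the compositions `g n ∘ ⋯ ∘ g (n + m - 1)` as `m → ∞`. -/
theorem exists_tailComp_limit {g : ℕ → ℂ → ℂ} (hg : GeometricallyNearId g)
    (n : ℕ) : ∃ G : ℂ → ℂ, ∀ z ∈ finiteExterior,
    Tendsto (fun m => tailComp g n m z) atTop (𝓝 (G z)) := by
  have h : ∀ z : ℂ, ∃ w, z ∈ finiteExterior → Tendsto (fun m => tailComp g n m z) atTop (𝓝 w) := by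
    intro z
    by_cases hz : z ∈ finiteExterior
    · obtain ⟨D, -, hD⟩ := hg.exists_dist_tailComp_le hz
      obtain ⟨w, hw⟩ := cauchySeq_tendsto_of_complete (cauchySeq_of_le_geometric (1 / 2)
        (D * (1 / 2) ^ n * ‖z‖) (by norm_num) fun m => hD n m z le_rfl)
      exact ⟨w, fun _ => hw⟩
    · exact ⟨0, fun h => absurd h hz⟩
  choose G hG using h
  exact ⟨G, fun z hz => hG z hz⟩

theorem exists_dist_tailComp_limit_le {g : ℕ → ℂ → ℂ} (hg : GeometricallyNearId g)
    {r : ℝ} (hr : 1 < r) :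
    ∃ D : ℝ, 0 ≤ D ∧ ∀ n m z w, r ≤ ‖z‖ → Tendsto (fun m => tailComp g n m z) atTop (𝓝 w) →
      dist (tailComp g n m z) w ≤ D * (1 / 2) ^ n * ‖z‖ * (1 / 2) ^ m := by
  obtain ⟨D, hD0, hD⟩ := hg.exists_dist_tailComp_le hr
  refine ⟨2 * D, by positivity, fun n m z w hz hw => ?_⟩
  refine (dist_le_of_le_geometric_of_tendsto (1 / 2) (D * (1 / 2) ^ n * ‖z‖) (by norm_num)
    (fun m => hD n m z hz) hw m).trans_eq ?_
  ring

/-- No Hurwitz argument is needed: `G` is an injective finite composition after the tail limit `T (n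
+ m)`, so `G a = G b` forces `T (n + m) a = T (n + m) b` for every `m`, and these tails converge to
the identity. -/
theorem injOn_limit {g : ℕ → ℂ → ℂ} (hg : GeometricallyNearId g)
    {n : ℕ} {G : ℂ → ℂ} (hG : ∀ z ∈ finiteExterior,
    Tendsto (fun m => tailComp g n m z) atTop (𝓝 (G z))) : Set.InjOn G finiteExterior := by
  intro a ha b hb hab
  choose T hT using hg.exists_tailComp_limit
  have hTU : ∀ j, ∀ z ∈ finiteExterior, T j z ∈ finiteExterior := fun j z hz =>
    lt_of_lt_of_le hz (ge_of_tendsto' (hT j z hz).norm fun m => hg.norm_le_tailComp j m z hz)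
  have hfac : ∀ m, ∀ z ∈ finiteExterior, G z = tailComp g n m (T (n + m) z) := by
    intro m z hz
    have h1 := (hG z hz).comp (tendsto_add_atTop_nat m)
    have h2 := ((hg.differentiableOn_tailComp n m).continuousOn.continuousAt
      (isOpen_finiteExterior.mem_nhds (hTU (n + m) z hz))).tendsto.comp (hT (n + m) z hz)
    refine tendsto_nhds_unique h1 (h2.congr fun j => ?_)
    rw [Function.comp_apply, Function.comp_apply, add_comm j m, tailComp_add]
    rfl
  have heq : ∀ m, T (n + m) a = T (n + m) b := fun m =>
    hg.injOn_tailComp n m (hTU _ a ha) (hTU _ b hb)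
      ((hfac m a ha).symm.trans (hab.trans (hfac m b hb)))
  have hlim : ∀ z ∈ finiteExterior, Tendsto (fun m => T (n + m) z) atTop (𝓝 z) := by
    intro z hz
    obtain ⟨D, -, hD⟩ := hg.exists_dist_tailComp_limit_le hz
    rw [tendsto_iff_dist_tendsto_zero]
    refine squeeze_zero (fun _ => dist_nonneg) (g := fun m => D * ‖z‖ * (1 / 2) ^ (n + m))
      (fun m => ?_) ?_
    · have := hD (n + m) 0 z _ le_rfl (hT (n + m) z hz)
      rw [dist_comm]
      refine this.trans_eq ?_
      ring
    · have h := (tendsto_pow_atTop_nhds_zero_of_lt_one (r := (1 / 2 : ℝ)) (by norm_num)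
        (by norm_num)).comp (tendsto_add_atTop_nat n)
      have := h.const_mul (D * ‖z‖)
      rw [mul_zero] at this
      refine this.congr fun m => ?_
      rw [Function.comp_apply, add_comm]
  exact tendsto_nhds_unique (hlim a ha) ((hlim b hb).congr fun m => (heq m).symm)

theorem tendstoUniformlyOn_limit {g : ℕ → ℂ → ℂ} (hg : GeometricallyNearId g)
    {n : ℕ} {G : ℂ → ℂ} (hG : ∀ z ∈ finiteExterior,
    Tendsto (fun m => tailComp g n m z) atTop (𝓝 (G z))) {K : Set ℂ} (hK : IsCompact K)
    (hKU : K ⊆ finiteExterior) : TendstoUniformlyOn (tailComp g n) G atTop K := by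
  obtain rfl | hne := K.eq_empty_or_nonempty
  · exact tendstoUniformlyOn_empty
  obtain ⟨a, ha, hmin⟩ := hK.exists_isMinOn hne continuous_norm.continuousOn
  obtain ⟨R, hR⟩ := hK.isBounded.exists_norm_le
  obtain ⟨D, hD0, hD⟩ := hg.exists_dist_tailComp_limit_le (hKU ha)
  rw [Metric.tendstoUniformlyOn_iff]
  intro ε hε
  have hlim : Tendsto (fun m : ℕ => D * (1 / 2) ^ n * R * (1 / 2 : ℝ) ^ m) atTop (𝓝 0) := by
    simpa using (tendsto_pow_atTop_nhds_zero_of_lt_one (r := (1 / 2 : ℝ)) (by norm_num)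
      (by norm_num)).const_mul (D * (1 / 2) ^ n * R)
  filter_upwards [hlim.eventually_lt_const hε] with m hm z hz
  rw [dist_comm]
  refine (hD n m z _ (hmin hz) (hG z (hKU hz))).trans_lt (lt_of_le_of_lt ?_ hm)
  gcongr
  exact hR z hz

theorem positiveAtInfinity_limit {g : ℕ → ℂ → ℂ} (hg : GeometricallyNearId g)
    {n : ℕ} {G : ℂ → ℂ} (hG : ∀ z ∈ finiteExterior,
    Tendsto (fun m => tailComp g n m z) atTop (𝓝 (G z))) : PositiveAtInfinity G := by
  obtain ⟨D, hD0, hD⟩ := hg.exists_dist_tailComp_limit_le (r := 2) one_lt_two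
  obtain ⟨E, hE0, hE⟩ := hg.exists_dist_tailComp_le (r := 2) one_lt_two
  choose b hb hlb using hg.positiveAtInfinity_tailComp n
  have hlarge : ∀ᶠ z : ℂ in Bornology.cobounded ℂ, 2 ≤ ‖z‖ :=
    (tendsto_norm_cobounded_atTop (E := ℂ)).eventually_ge_atTop 2
  have hbstep : ∀ m, dist (b m) (b (m + 1)) ≤ E * (1 / 2) ^ n * (1 / 2) ^ m := by
    intro m
    have h : dist ((b m : ℝ) : ℂ) (b (m + 1)) ≤ E * (1 / 2) ^ n * (1 / 2) ^ m := by
      refine le_of_tendsto ((hlb m).dist (hlb (m + 1))) ?_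
      filter_upwards [hlarge] with z hz
      have hz0 : 0 < ‖z‖ := by linarith
      rw [dist_eq_norm, ← sub_div, norm_div, div_le_iff₀ hz0, ← dist_eq_norm]
      exact (hE n m z hz).trans_eq (by ring)
    rwa [Complex.dist_eq, ← Complex.ofReal_sub, Complex.norm_real] at h
  -- Expansion keeps the leading coefficients away from 0, so their limit is still positive.
  have hb1 : ∀ m, 1 ≤ b m := by
    intro m
    have h : (1 : ℝ) ≤ ‖((b m : ℝ) : ℂ)‖ := by
      refine ge_of_tendsto (hlb m).norm ?_
      filter_upwards [finiteExterior_mem_cobounded] with z hz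
      rw [norm_div, one_le_div (norm_pos_iff.2 (ne_zero_of_mem_finiteExterior hz))]
      exact hg.norm_le_tailComp n m z hz
    rwa [Complex.norm_real, Real.norm_of_nonneg (hb m).le] at h
  obtain ⟨β, hβ⟩ := cauchySeq_tendsto_of_complete
    (cauchySeq_of_le_geometric (1 / 2) _ (by norm_num) hbstep)
  refine ⟨β, one_pos.trans_le (ge_of_tendsto' hβ hb1), ?_⟩
  -- The limits in `m` and in `z → ∞` may be interchanged: after division by `z` the error is
  -- uniform on `|z| ≥ 2`.
  refine TendstoUniformlyOnFilter.tendsto_of_eventually_tendsto (p := atTop)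
    (F := fun m z => tailComp g n m z / z) (L := fun m => ((b m : ℝ) : ℂ)) ?_
    (Eventually.of_forall hlb) ((Complex.continuous_ofReal.tendsto β).comp hβ)
  rw [Metric.tendstoUniformlyOnFilter_iff]
  intro ε hε
  have hlim : Tendsto (fun m : ℕ => D * (1 / 2) ^ n * (1 / 2 : ℝ) ^ m) atTop (𝓝 0) := by
    simpa using (tendsto_pow_atTop_nhds_zero_of_lt_one (r := (1 / 2 : ℝ)) (by norm_num)
      (by norm_num)).const_mul (D * (1 / 2) ^ n)
  filter_upwards [(hlim.eventually_lt_const hε).prod_mk hlarge] with ⟨m, z⟩ ⟨hm, hz⟩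
  have hz0 : 0 < ‖z‖ := by linarith
  rw [dist_comm, dist_eq_norm, ← sub_div, norm_div, ← dist_eq_norm]
  refine lt_of_le_of_lt ((div_le_iff₀ hz0).2 ?_) hm
  exact (hD n m z _ hz (hG z (lt_of_lt_of_le one_lt_two hz))).trans_eq (by ring)

theorem sigmaPrime_limit {g : ℕ → ℂ → ℂ} (hg : GeometricallyNearId g)
    {n : ℕ} {G : ℂ → ℂ} (hG : ∀ z ∈ finiteExterior,
    Tendsto (fun m => tailComp g n m z) atTop (𝓝 (G z))) : SigmaPrime G where
  holo := ((tendstoLocallyUniformlyOn_iff_forall_isCompact isOpen_finiteExterior).2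
    fun _ hKU hK => hg.tendstoUniformlyOn_limit hG hK hKU).differentiableOn
      (Eventually.of_forall fun m => hg.differentiableOn_tailComp n m) isOpen_finiteExterior
  inj := hg.injOn_limit hG
  mapsTo z hz := lt_of_lt_of_le hz
    (ge_of_tendsto' (hG z hz).norm fun m => hg.norm_le_tailComp n m z hz)
  atInfinity := hg.positiveAtInfinity_limit hG

end GeometricallyNearId

/-! ### Spherical convergence and the conclusion -/

/-- Locally uniform convergence of expanding maps of the exterior disc implies spherically uniform
convergence on compact subsets of the exterior disc in the Riemann sphere. -/
theorem sphericallyUniformOn_of_norm_le {F : ℕ → ℂ → ℂ} {f : ℂ → ℂ}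
    (hF : ∀ n, ∀ z ∈ finiteExterior, ‖z‖ ≤ ‖F n z‖) (hf : ContinuousOn f finiteExterior)
    (hloc : TendstoLocallyUniformlyOn F f atTop finiteExterior)
    {K : Set (OnePoint ℂ)} (hK : IsCompact K) (hKU : K ⊆ exteriorDisc) :
    SphericallyUniformOn (fun n => OnePoint.map (F n)) (OnePoint.map f) K := by
  let _ : UniformSpace (OnePoint ℂ) := uniformSpaceOfCompactR1
  change TendstoUniformlyOn (fun n => OnePoint.map (F n)) (OnePoint.map f) atTop K
  rw [← tendstoLocallyUniformlyOn_iff_tendstoUniformlyOn_of_compact hK]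
  have hff : ∀ z ∈ finiteExterior, ‖z‖ ≤ ‖f z‖ := fun z hz =>
    ge_of_tendsto' (hloc.tendsto_at hz).norm fun n => hF n z hz
  -- Joint convergence in `(n, y)` at each point yields local uniformity. At finite points it comes
  -- from `hloc`; at `∞` both maps tend to `∞` by expansion alone.
  have main : ∀ x ∈ exteriorDisc, Tendsto
      (fun y : ℕ × OnePoint ℂ => (OnePoint.map f y.2, OnePoint.map (F y.1) y.2))
      (atTop ×ˢ 𝓝 x) (𝓝 (OnePoint.map f x) ×ˢ 𝓝 (OnePoint.map f x)) := by
    rintro x (⟨z, hz, rfl⟩ | rfl)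
    · have hzn := isOpen_finiteExterior.mem_nhds hz
      have hfz : ContinuousAt f z := hf.continuousAt hzn
      have hpair : Tendsto (fun y : ℕ × ℂ => (f y.2, F y.1 y.2)) (atTop ×ˢ 𝓝 z)
          (𝓝 (f z) ×ˢ 𝓝 (f z)) := by
        refine (hfz.tendsto.comp tendsto_snd).prodMk ?_
        rw [Metric.tendsto_nhds]
        intro ε hε
        obtain ⟨t, ht, hev⟩ := Metric.tendstoLocallyUniformlyOn_iff.1 hloc (ε / 2) (half_pos hε)
          z hz
        rw [isOpen_finiteExterior.nhdsWithin_eq hz] at ht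
        filter_upwards [hev.prod_mk (inter_mem ht (hfz (Metric.ball_mem_nhds _ (half_pos hε))))]
          with ⟨n, w⟩ ⟨hn, hwt, hwf⟩
        have h1 := hn w hwt
        have h2 : dist (f w) (f z) < ε / 2 := hwf
        rw [dist_comm] at h1
        linarith [dist_triangle (F n w) (f w) (f z)]
      have hcoe : Tendsto ((↑) : ℂ → OnePoint ℂ) (𝓝 (f z)) (𝓝 (f z : OnePoint ℂ)) :=
        OnePoint.continuous_coe.tendsto _
      rw [OnePoint.nhds_coe_eq, ← Filter.map_id (f := (atTop : Filter ℕ)), Filter.prod_map_map_eq,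
        tendsto_map'_iff]
      exact (hcoe.prodMap hcoe).comp hpair
    · rw [OnePoint.map_infty]
      have key : ∀ h : ℕ → ℂ → ℂ, (∀ n, ∀ z ∈ finiteExterior, ‖z‖ ≤ ‖h n z‖) →
          Tendsto (fun y : ℕ × OnePoint ℂ => OnePoint.map (h y.1) y.2)
            (atTop ×ˢ 𝓝 OnePoint.infty) (𝓝 OnePoint.infty) := by
        intro h hh
        refine OnePoint.le_nhds_infty.2 fun s _ hs => ?_
        obtain ⟨R, hR⟩ := hs.isBounded.exists_norm_le
        have hnb : ((↑) '' (Metric.closedBall (0 : ℂ) (max 1 R))ᶜ ∪ {OnePoint.infty} :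
            Set (OnePoint ℂ)) ∈ 𝓝 (OnePoint.infty : OnePoint ℂ) :=
          OnePoint.le_nhds_infty.1 le_rfl _ Metric.isClosed_closedBall (isCompact_closedBall _ _)
        refine mem_map.2 (mem_of_superset (prod_mem_prod univ_mem hnb) ?_)
        rintro ⟨n, x⟩ ⟨-, ⟨z, hz, rfl⟩ | rfl⟩
        · refine Or.inl ⟨h n z, fun hmem => hz ?_, rfl⟩
          rw [mem_closedBall_zero_iff]
          by_contra! hlt
          have hz1 : z ∈ finiteExterior := (le_max_left _ _).trans_lt hlt
          exact absurd ((hh n z hz1).trans (hR _ hmem)) (not_le.2 ((le_max_right _ _).trans_lt hlt))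
        · exact Or.inr rfl
      exact (key (fun _ => f) fun _ => hff).prodMk (key F hF)
  rw [tendstoLocallyUniformlyOn_iff_forall_tendsto]
  intro x hx
  refine (main x (hKU hx)).mono_left (prod_mono le_rfl nhdsWithin_le_nhds) |>.mono_right ?_
  rw [← nhds_prod_eq]
  exact nhds_le_uniformity _

theorem mainTheorem1 (φ : ℂ → ℂ) (hφ : SigmaPrime φ) (k : ℕ) (hk : 2 ≤ k) (θ : ℕ → ℝ) :
    ∃ f : ℂ → ℂ, SigmaPrime f ∧
      (∀ K : Set ℂ, IsCompact K → K ⊆ finiteExterior →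
        TendstoUniformlyOn (snowflakeApprox φ k θ) f atTop K) ∧
      (∀ K : Set (OnePoint ℂ), IsCompact K → K ⊆ exteriorDisc →
        SphericallyUniformOn (fun n => OnePoint.map (snowflakeApprox φ k θ n))
          (OnePoint.map f) K) := by
  obtain ⟨l, hl, ⟨c, hc⟩, hle⟩ := hφ.exists_log
  have hg := hφ.geometricallyNearId hl hc hle hk θ
  set g : ℕ → ℂ → ℂ := fun n => koebeOfLog l (k ^ n) (Complex.exp (θ n * Complex.I)) with hgdef
  -- The shift by one: the `n`-th approximation has `n + 1` factors, the zeroth being the rotation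
  -- itself because `k ^ 0 = 1`.
  have happrox : ∀ n, Set.EqOn (tailComp g 0 (n + 1)) (snowflakeApprox φ k θ n)
      finiteExterior := by
    intro n
    induction n with
    | zero =>
      intro z hz
      have := rotate_eq_koebeOfLog hle (θ 0) hz
      simpa [tailComp, snowflakeApprox, hgdef] using this.symm
    | succ n ih =>
      intro z hz
      have h1 : koebe (k ^ (n + 1)) (rotate φ (θ (n + 1))) z = g (n + 1) z :=
        koebe_eqOn_koebeOfLog hl hc hle (pow_ne_zero _ (by omega)) (θ (n + 1)) hz
      rw [snowflakeApprox, Function.comp_apply, h1, ← ih (hg.mapsTo _ hz), tailComp, zero_add]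
      rfl
  obtain ⟨f, hf⟩ := hg.exists_tailComp_limit 0
  have hfS := hg.sigmaPrime_limit hf
  have hunif : ∀ K : Set ℂ, IsCompact K → K ⊆ finiteExterior →
      TendstoUniformlyOn (snowflakeApprox φ k θ) f atTop K := by
    intro K hK hKU
    have h : TendstoUniformlyOn (fun n => tailComp g 0 (n + 1)) f atTop K := fun u hu =>
      (tendsto_add_atTop_nat 1).eventually (hg.tendstoUniformlyOn_limit hf hK hKU u hu)
    exact h.congr (Eventually.of_forall fun n => (happrox n).mono hKU)
  refine ⟨f, hfS, hunif, fun K hK hKU => sphericallyUniformOn_of_norm_le (fun n z hz => ?_)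
    hfS.holo.continuousOn ((tendstoLocallyUniformlyOn_iff_forall_isCompact
      isOpen_finiteExterior).2 fun K hKU hK => hunif K hK hKU) hK hKU⟩
  rw [← happrox n hz]
  exact hg.norm_le_tailComp 0 (n + 1) z hz
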